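/- A real matrix is called totally positive (TP) if all of its minors, of every order, are positive. A $2\times 2$ minor of a $2\times n$ matrix is the determinant of the submatrix formed by two columns $i<j$. There is an absolute constant $C$ such that for every $n$, every $2\times n$ TP matrix $A$ and every real number $v$, at most $C\,n^{4/3}$ of the $2\times 2$ minors of $A$ are equal to $v$. This bound is asymptotically tight: there is an absolute constant $c>0$ such that for every $n\ge 2$ there exist a $2\times n$ TP matrix $A$ and a real number $v$ such that at least $c\,n^{4/3}$ of the $2\times 2$ minors of $A$ are equal to $v$. -/

import Mathlib

/-- The minor of `A` on the rows `I` and the columns `J`. A choice of `k` row indices is written as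
an increasing enumeration `Fin k ↪o Fin m`, so that the chosen rows (and columns) keep their order;
such enumerations correspond one-to-one to the `k`-element subsets of `Fin m`. -/
def minor {m n k : ℕ} (A : Matrix (Fin m) (Fin n) ℝ) (I : Fin k ↪o Fin m) (J : Fin k ↪o Fin n) :
    ℝ :=
  (A.submatrix I J).det

/-- A real matrix is totally positive if all its minors, of all orders, are positive
(the empty minor, of order `0`, equals `1`, so including it is harmless). -/
def IsTotallyPositive {m n : ℕ} (A : Matrix (Fin m) (Fin n) ℝ) : Prop :=
  ∀ (k : ℕ) (I : Fin k ↪o Fin m) (J : Fin k ↪o Fin n), 0 < minor A I J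

/-- The number of `k × k` minors of `A` (one for each choice of a `k`-set of rows and a `k`-set of
columns) whose value is `v`. -/
noncomputable def minorCount {m n : ℕ} (k : ℕ) (A : Matrix (Fin m) (Fin n) ℝ) (v : ℝ) : ℕ :=
  {p : (Fin k ↪o Fin m) × (Fin k ↪o Fin n) | minor A p.1 p.2 = v}.ncard

/-! Upper bound: write column `j` as `(a_j, b_j)`. Dividing `a_i b_j - a_j b_i = v` by `v a_j` says
that the point `(b_j/a_j, 1/a_j)` lies on the line of slope `a_i/v` and intercept `-b_i/v`. Total
positivity makes `b_j/a_j` strictly increasing, so there are `n` points with distinct abscissas and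
`n` distinct lines, and the Szemerédi–Trotter bound `card_incidences_mul_le` applies.

That bound follows Székely's argument. In a crossing-free drawing, each edge is topmost at its left
end, topmost at its right end, or seen from above by a vertex; each class injects into the vertices,
so `E ≤ 3V` (`card_le_of_not_cross`). Averaging over random vertex subsets gives the crossing
inequality `card_edges_mul_le`, used on the graph joining consecutive points of each line, where two
lines cross at most once.

Lower bound: the minor of `ρ_a (1, τ_a)` and `ρ_b (1, τ_b)` is `ρ_a ρ_b (τ_b - τ_a)`. In
`exists_minorCount_ge` the points and lines of a grid with many incidences are encoded as such
vectors, an incidence giving minor `1`. -/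

/-! ### Straight-line drawings. -/

/-- A drawing of a graph with vertex set `V` and edge set `ι` by straight segments, where the
vertices have increasing abscissas, no vertex lies in the interior of an edge, and there are no
multiple edges. -/
structure StraightLineDrawing (V ι : Type*) [LinearOrder V] where
  /-- The abscissa of a vertex. -/
  x : V → ℝ
  /-- The ordinate of a vertex. -/
  y : V → ℝ
  /-- The left endpoint of an edge. -/
  lo : ι → V
  /-- The right endpoint of an edge. -/
  hi : ι → V
  /-- The slope of the line carrying an edge. -/
  slope : ι → ℝ
  /-- The intercept of the line carrying an edge. -/
  icpt : ι → ℝ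
  x_strictMono : StrictMono x
  lo_lt_hi : ∀ e, lo e < hi e
  height_lo : ∀ e, slope e * x (lo e) + icpt e = y (lo e)
  height_hi : ∀ e, slope e * x (hi e) + icpt e = y (hi e)
  height_ne : ∀ e v, lo e < v → v < hi e → slope e * x v + icpt e ≠ y v
  edge_ext : ∀ e f, lo e = lo f → hi e = hi f → e = f

namespace StraightLineDrawing

variable {V ι : Type*} [LinearOrder V] (D : StraightLineDrawing V ι)

/-- The ordinate at abscissa `z` of the line carrying the edge `e`. -/
def height (e : ι) (z : ℝ) : ℝ := D.slope e * z + D.icpt e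

/-- Two edges cross if their relative interiors meet. -/
def Cross (e f : ι) : Prop :=
  ∃ z, D.x (D.lo e) < z ∧ z < D.x (D.hi e) ∧ D.x (D.lo f) < z ∧ z < D.x (D.hi f) ∧
    D.height e z = D.height f z

lemma height_lo' (e : ι) : D.height e (D.x (D.lo e)) = D.y (D.lo e) := D.height_lo e

lemma height_hi' (e : ι) : D.height e (D.x (D.hi e)) = D.y (D.hi e) := D.height_hi e

lemma continuous_height (e : ι) : Continuous (D.height e) := by
  unfold height; fun_prop

variable {D}

/-- Two edges whose vertical order changes over an interval which both span cross. -/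
lemma cross_of_lt_of_lt {e f : ι} {u v : V} (huv : u < v)
    (heu : D.lo e ≤ u) (hev : v ≤ D.hi e) (hfu : D.lo f ≤ u) (hfv : v ≤ D.hi f)
    (h1 : D.height e (D.x u) < D.height f (D.x u))
    (h2 : D.height f (D.x v) < D.height e (D.x v)) : D.Cross e f := by
  have hx := D.x_strictMono huv
  have hc : ContinuousOn (fun z => D.height e z - D.height f z) (Set.Icc (D.x u) (D.x v)) :=
    ((D.continuous_height e).sub (D.continuous_height f)).continuousOn
  obtain ⟨z, ⟨hz1, hz2⟩, hz⟩ := intermediate_value_Ioo hx.le hc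
    (show (0 : ℝ) ∈ Set.Ioo _ _ from ⟨by linarith, by linarith⟩)
  have hm := D.x_strictMono.monotone
  exact ⟨z, (hm heu).trans_lt hz1, hz2.trans_le (hm hev), (hm hfu).trans_lt hz1,
    hz2.trans_le (hm hfv), by simpa [sub_eq_zero] using hz⟩

lemma cross_of_lo_eq {e f : ι} (hlo : D.lo e = D.lo f) (hs : D.slope e = D.slope f) :
    D.Cross e f := by
  have he := D.x_strictMono (D.lo_lt_hi e)
  have hf := D.x_strictMono (D.lo_lt_hi f)
  have h1 := D.height_lo e
  have h2 := D.height_lo f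
  rw [hlo] at he h1
  obtain ⟨z, hz1, hz2⟩ := exists_between (lt_min he hf)
  refine ⟨z, by rwa [hlo], hz2.trans_le (min_le_left _ _), hz1, hz2.trans_le (min_le_right _ _), ?_⟩
  unfold height
  rw [hs] at h1 ⊢
  linarith

lemma cross_of_hi_eq {e f : ι} (hhi : D.hi e = D.hi f) (hs : D.slope e = D.slope f) :
    D.Cross e f := by
  have he := D.x_strictMono (D.lo_lt_hi e)
  have hf := D.x_strictMono (D.lo_lt_hi f)
  have h1 := D.height_hi e
  have h2 := D.height_hi f
  rw [hhi] at he h1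
  obtain ⟨z, hz1, hz2⟩ := exists_between (max_lt he hf)
  refine ⟨z, (le_max_left _ _).trans_lt hz1, by rwa [hhi], (le_max_right _ _).trans_lt hz1, hz2, ?_⟩
  unfold height
  rw [hs] at h1 ⊢
  linarith

lemma height_lt_of_lo_eq {e f : ι} (hlo : D.lo e = D.lo f) (hs : D.slope e < D.slope f) {v : V}
    (hv : D.lo e < v) : D.height e (D.x v) < D.height f (D.x v) := by
  have h := D.x_strictMono hv
  have h1 := D.height_lo e
  have h2 := D.height_lo f
  rw [← hlo] at h2
  unfold height
  nlinarith [mul_pos (sub_pos.2 hs) (sub_pos.2 h)]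

lemma slope_lt_of_lo_eq {e f : ι} (hlo : D.lo e = D.lo f) {v : V}
    (hv : D.lo e < v) (h : D.height e (D.x v) < D.height f (D.x v)) : D.slope e < D.slope f := by
  have hx := D.x_strictMono hv
  have h1 := D.height_lo e
  have h2 := D.height_lo f
  rw [← hlo] at h2
  unfold height at h
  by_contra! hs
  nlinarith [mul_nonneg (sub_nonneg.2 hs) (sub_pos.2 hx).le]

lemma height_lt_of_hi_eq {e f : ι} (hhi : D.hi e = D.hi f) (hs : D.slope f < D.slope e) {v : V}
    (hv : v < D.hi e) : D.height e (D.x v) < D.height f (D.x v) := by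
  have h := D.x_strictMono hv
  have h1 := D.height_hi e
  have h2 := D.height_hi f
  rw [← hhi] at h2
  unfold height
  nlinarith [mul_pos (sub_pos.2 hs) (sub_pos.2 h)]

/-! ### Linear edge bound for crossing-free drawings. -/

/-- `v` lies vertically above the interior of `e`, and no edge of `E` passes between them. -/
def SeesBelow (D : StraightLineDrawing V ι) (E : Finset ι) (v : V) (e : ι) : Prop :=
  D.lo e < v ∧ v < D.hi e ∧ D.height e (D.x v) < D.y v ∧
    ∀ f ∈ E, D.lo f < v → v < D.hi f → D.height e (D.x v) < D.height f (D.x v) →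
      D.y v < D.height f (D.x v)

/-- In a crossing-free family, an edge which is neither the topmost edge to the right of its left
endpoint nor the topmost edge to the left of its right endpoint is seen by a vertex above it. -/
lemma exists_seesBelow {S : Finset V} {E : Finset ι}
    (hlo : ∀ e ∈ E, D.lo e ∈ S) (hhi : ∀ e ∈ E, D.hi e ∈ S)
    (hnc : ∀ e ∈ E, ∀ f ∈ E, e ≠ f → ¬ D.Cross e f) {e : ι} (he : e ∈ E)
    (hr : ∃ f ∈ E, D.lo f = D.lo e ∧ D.slope e < D.slope f)
    (hl : ∃ f ∈ E, D.hi f = D.hi e ∧ D.slope f < D.slope e) :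
    ∃ v ∈ S, D.SeesBelow E v e := by
  classical
  have hnc' : ∀ e ∈ E, ∀ f ∈ E, ∀ v, D.height e v ≠ D.height f v → ¬ D.Cross e f :=
    fun e he f hf v hv => hnc e he f hf (by rintro rfl; exact hv rfl)
  -- `g` is the next edge above `e` in the rotation around their common left endpoint.
  obtain ⟨g, hg, hgmin⟩ := (E.filter fun f => D.lo f = D.lo e ∧ D.slope e < D.slope f).exists_min_image
    D.slope (by obtain ⟨f, hf, h⟩ := hr; exact ⟨f, Finset.mem_filter.2 ⟨hf, h⟩⟩)
  obtain ⟨hgE, hgl, hgs⟩ := Finset.mem_filter.1 hg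
  have heg : ∀ v, D.lo e < v → D.height e (D.x v) < D.height g (D.x v) :=
    fun v hv => height_lt_of_lo_eq hgl.symm hgs hv
  have hlog : ∀ v, D.lo e < v → D.lo g < v := fun v hv => hgl ▸ hv
  -- The vertices in the wedge above `e` and weakly below `g`. If `g` ends before `e`, its right end
  -- is one; otherwise an edge arriving at the right end of `e` from above cannot cross `g`, so it
  -- starts in the wedge.
  let W := S.filter fun v => D.lo e < v ∧ v < D.hi e ∧ v ≤ D.hi g ∧
    D.height e (D.x v) < D.y v ∧ D.y v ≤ D.height g (D.x v)
  have hW : W.Nonempty := by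
    rcases lt_trichotomy (D.hi g) (D.hi e) with h | h | h
    · have hv : D.lo e < D.hi g := hgl ▸ D.lo_lt_hi g
      have := heg _ hv
      rw [height_hi'] at this
      exact ⟨D.hi g, Finset.mem_filter.2 ⟨hhi g hgE, hv, h, le_rfl, this, (D.height_hi' g).ge⟩⟩
    · rw [D.edge_ext g e hgl h] at hgs
      exact absurd hgs (lt_irrefl _)
    · obtain ⟨f, hfE, hfh, hfs⟩ := hl
      have hef : ∀ v, v < D.hi e → D.height e (D.x v) < D.height f (D.x v) :=
        fun v hv => height_lt_of_hi_eq hfh.symm hfs hv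
      have hfg : D.height f (D.x (D.hi e)) < D.height g (D.x (D.hi e)) := by
        have := heg _ (D.lo_lt_hi e)
        rwa [height_hi', ← hfh, ← height_hi', hfh] at this
      have hncfg := hnc' g hgE f hfE _ hfg.ne'
      have hkey : ∀ u, D.lo e ≤ u → u < D.hi e → D.lo f ≤ u →
          D.height f (D.x u) ≤ D.height g (D.x u) := by
        intro u hu1 hu2 hu3
        by_contra! hlt
        exact hncfg (cross_of_lt_of_lt hu2 (hgl ▸ hu1) h.le hu3 hfh.ge hlt hfg)
      rcases lt_trichotomy (D.lo f) (D.lo e) with h' | h' | h'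
      · have h1 := hkey _ le_rfl (D.lo_lt_hi e) h'.le
        have h2 := hef _ (D.lo_lt_hi e)
        rw [height_lo', ← hgl, ← height_lo', hgl] at h2
        linarith
      · rw [D.edge_ext f e h' hfh] at hfs
        exact absurd hfs (lt_irrefl _)
      · have hlt : D.lo f < D.hi e := hfh ▸ D.lo_lt_hi f
        have h1 := hef _ hlt
        have h2 := hkey _ h'.le hlt le_rfl
        rw [height_lo'] at h1 h2
        exact ⟨D.lo f, Finset.mem_filter.2 ⟨hlo f hfE, h', hlt, (hlt.trans h).le, h1, h2⟩⟩
  -- The leftmost vertex of the wedge sees `e`. An edge separating them would stay between `e` and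
  -- `g` when followed leftwards, hence would pass through their common endpoint, start there below
  -- `g`, or start at a wedge vertex further left.
  obtain ⟨v, hvW, hvmin⟩ := W.exists_min_image id hW
  obtain ⟨hvS, hv1, hv2, hv3, hv4, hv5⟩ := Finset.mem_filter.1 hvW
  refine ⟨v, hvS, hv1, hv2, hv4, fun f hfE hf1 hf2 hef => ?_⟩
  by_contra! hfv
  have hfv : D.height f (D.x v) < D.y v := lt_of_le_of_ne hfv (D.height_ne f v hf1 hf2)
  have hfg : D.height f (D.x v) < D.height g (D.x v) := hfv.trans_le hv5
  have hncfe := hnc' f hfE e he _ hef.ne'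
  have hncfg := hnc' g hgE f hfE _ hfg.ne'
  have hge : ∀ u, D.lo e ≤ u → u < v → D.lo f ≤ u → D.height e (D.x u) ≤ D.height f (D.x u) := by
    intro u hu1 hu2 hu3
    by_contra! hlt
    exact hncfe (cross_of_lt_of_lt hu2 hu3 hf2.le hu1 hv2.le hlt hef)
  have hle : ∀ u, D.lo e ≤ u → u < v → D.lo f ≤ u → D.height f (D.x u) ≤ D.height g (D.x u) := by
    intro u hu1 hu2 hu3
    by_contra! hlt
    exact hncfg (cross_of_lt_of_lt hu2 (hgl ▸ hu1) hv3 hu3 hf2.le hlt hfg)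
  rcases lt_trichotomy (D.lo f) (D.lo e) with h | h | h
  · have h1 := hge _ le_rfl hv1 h.le
    have h2 := hle _ le_rfl hv1 h.le
    rw [height_lo'] at h1
    rw [← hgl, height_lo', hgl] at h2
    exact D.height_ne f _ h (hv1.trans hf2) (le_antisymm h2 h1)
  · have h1 := slope_lt_of_lo_eq h.symm hv1 hef
    have h2 := slope_lt_of_lo_eq (h.trans hgl.symm) hf1 hfg
    exact absurd (hgmin f (Finset.mem_filter.2 ⟨hfE, h, h1⟩)) (not_le.2 h2)
  · have h1 := hge _ h.le hf1 le_rfl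
    have h2 := hle _ h.le hf1 le_rfl
    rw [height_lo'] at h1 h2
    have h3 := lt_of_le_of_ne h1 (D.height_ne e _ h (hf1.trans hv2))
    exact absurd (hvmin _ (Finset.mem_filter.2
      ⟨hlo f hfE, h, hf1.trans hv2, hf1.le.trans hv3, h3, h2⟩)) (not_le.2 hf1)

/-- A vertex sees at most one edge below it. -/
lemma SeesBelow.unique {E : Finset ι} (hnc : ∀ e ∈ E, ∀ f ∈ E, e ≠ f → ¬ D.Cross e f)
    {e f : ι} (he : e ∈ E) (hf : f ∈ E) {v : V} (hve : D.SeesBelow E v e)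
    (hvf : D.SeesBelow E v f) : e = f := by
  by_contra hef
  obtain ⟨he1, he2, he3, he4⟩ := hve
  obtain ⟨hf1, hf2, hf3, hf4⟩ := hvf
  rcases lt_trichotomy (D.height e (D.x v)) (D.height f (D.x v)) with h | h | h
  · exact absurd (he4 f hf hf1 hf2 h) (not_lt.2 hf3.le)
  · exact hnc e he f hf hef ⟨D.x v, D.x_strictMono he1, D.x_strictMono he2, D.x_strictMono hf1,
      D.x_strictMono hf2, h⟩
  · exact absurd (hf4 e he he1 he2 h) (not_lt.2 he3.le)

/-- A crossing-free straight-line graph has at most three times as many edges as vertices. -/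
lemma card_le_of_not_cross {S : Finset V} {E : Finset ι}
    (hlo : ∀ e ∈ E, D.lo e ∈ S) (hhi : ∀ e ∈ E, D.hi e ∈ S)
    (hnc : ∀ e ∈ E, ∀ f ∈ E, e ≠ f → ¬ D.Cross e f) : E.card ≤ 3 * S.card := by
  classical
  let A := E.filter fun e => ∀ f ∈ E, D.lo f = D.lo e → D.slope f ≤ D.slope e
  let B := E.filter fun e => ∀ f ∈ E, D.hi f = D.hi e → D.slope e ≤ D.slope f
  let C := E.filter fun e => ∃ v ∈ S, D.SeesBelow E v e
  have hcover : E ⊆ A ∪ B ∪ C := by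
    intro e he
    by_contra h
    simp only [A, B, C, Finset.mem_union, Finset.mem_filter, he, true_and, not_or] at h
    push Not at h
    obtain ⟨⟨h1, h2⟩, h3⟩ := h
    obtain ⟨v, hvS, hv⟩ := exists_seesBelow hlo hhi hnc he h1 h2
    exact h3 v hvS hv
  have hA : A.card ≤ S.card := by
    refine Finset.card_le_card_of_injOn D.lo (fun e he => hlo e (Finset.mem_filter.1 he).1) ?_
    intro e he f hf hef
    obtain ⟨he1, he2⟩ := Finset.mem_filter.1 (Finset.mem_coe.1 he)
    obtain ⟨hf1, hf2⟩ := Finset.mem_filter.1 (Finset.mem_coe.1 hf)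
    by_contra hne
    exact hnc e he1 f hf1 hne
      (cross_of_lo_eq hef (le_antisymm (hf2 e he1 hef) (he2 f hf1 hef.symm)))
  have hB : B.card ≤ S.card := by
    refine Finset.card_le_card_of_injOn D.hi (fun e he => hhi e (Finset.mem_filter.1 he).1) ?_
    intro e he f hf hef
    obtain ⟨he1, he2⟩ := Finset.mem_filter.1 (Finset.mem_coe.1 he)
    obtain ⟨hf1, hf2⟩ := Finset.mem_filter.1 (Finset.mem_coe.1 hf)
    by_contra hne
    exact hnc e he1 f hf1 hne
      (cross_of_hi_eq hef (le_antisymm (he2 f hf1 hef.symm) (hf2 e he1 hef)))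
  have hC : C.card ≤ S.card := by
    have hex : ∀ e ∈ C, ∃ v ∈ S, D.SeesBelow E v e := fun e he => (Finset.mem_filter.1 he).2
    rcases C.eq_empty_or_nonempty with h0 | ⟨e₀, he₀⟩
    · simp [h0]
    have : Nonempty V := ⟨D.lo e₀⟩
    choose! φ hφS hφ using hex
    refine Finset.card_le_card_of_injOn φ hφS ?_
    intro e he f hf hef
    have h := hφ e he
    rw [hef] at h
    exact h.unique hnc (Finset.mem_filter.1 (Finset.mem_coe.1 he)).1
      (Finset.mem_filter.1 (Finset.mem_coe.1 hf)).1 (hφ f hf)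
  calc E.card ≤ (A ∪ B ∪ C).card := Finset.card_le_card hcover
    _ ≤ A.card + B.card + C.card :=
      (Finset.card_union_le _ _).trans (Nat.add_le_add_right (Finset.card_union_le _ _) _)
    _ ≤ 3 * S.card := by omega

/-! ### Counting crossings. -/

open Classical in
/-- The ordered pairs of distinct crossing edges. -/
noncomputable def crossings [Fintype ι] (D : StraightLineDrawing V ι) : Finset (ι × ι) :=
  Finset.univ.filter fun p => p.1 ≠ p.2 ∧ D.Cross p.1 p.2

lemma mem_crossings [Fintype ι] {p : ι × ι} :
    p ∈ D.crossings ↔ p.1 ≠ p.2 ∧ D.Cross p.1 p.2 := by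
  simp [crossings]

-- Deleting the first edge of every ordered crossing pair inside `S` leaves a crossing-free family.
open Classical in
lemma card_le_add_card_crossings [Fintype ι] (D : StraightLineDrawing V ι) (S : Finset V) :
    (Finset.univ.filter fun e => D.lo e ∈ S ∧ D.hi e ∈ S).card ≤ 3 * S.card +
      (D.crossings.filter fun p =>
        (D.lo p.1 ∈ S ∧ D.hi p.1 ∈ S) ∧ D.lo p.2 ∈ S ∧ D.hi p.2 ∈ S).card := by
  set E := Finset.univ.filter fun e => D.lo e ∈ S ∧ D.hi e ∈ S with hE
  set X := D.crossings.filter fun p =>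
        (D.lo p.1 ∈ S ∧ D.hi p.1 ∈ S) ∧ D.lo p.2 ∈ S ∧ D.hi p.2 ∈ S with hX
  have hmem : ∀ e, e ∈ E ↔ D.lo e ∈ S ∧ D.hi e ∈ S := by simp [hE]
  have h1 : (E \ X.image Prod.fst).card ≤ 3 * S.card := by
    refine card_le_of_not_cross (D := D) ?_ ?_ ?_
    · exact fun e he => ((hmem e).1 (Finset.mem_sdiff.1 he).1).1
    · exact fun e he => ((hmem e).1 (Finset.mem_sdiff.1 he).1).2
    · intro e he f hf hef hc
      obtain ⟨he1, he2⟩ := Finset.mem_sdiff.1 he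
      refine he2 (Finset.mem_image.2 ⟨(e, f), ?_, rfl⟩)
      rw [hX, Finset.mem_filter, mem_crossings]
      exact ⟨⟨hef, hc⟩, (hmem e).1 he1, (hmem f).1 (Finset.mem_sdiff.1 hf).1⟩
  have h2 : E.card ≤ (E \ X.image Prod.fst).card + (X.image Prod.fst).card := by
    rw [← Finset.card_union_of_disjoint Finset.sdiff_disjoint]
    exact Finset.card_le_card (by simp)
  have h3 : (X.image Prod.fst).card ≤ X.card := Finset.card_image_le
  omega

/-- `Cross` also allows collinear overlap. Overlapping collinear edges either have an endpoint of
one inside the other, against `height_ne`, or share both endpoints and coincide. -/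
lemma slope_ne_of_cross {e f : ι} (hef : e ≠ f) (h : D.Cross e f) : D.slope e ≠ D.slope f := by
  intro hs
  obtain ⟨z, h1, h2, h3, h4, h5⟩ := h
  unfold height at h5
  have hi : D.icpt e = D.icpt f := by rw [hs] at h5; linarith
  have a1 : D.lo e < D.hi f := D.x_strictMono.lt_iff_lt.1 (h1.trans h4)
  have a2 : D.lo f < D.hi e := D.x_strictMono.lt_iff_lt.1 (h3.trans h2)
  have b1 := D.height_lo e
  have b2 := D.height_lo f
  have b3 := D.height_hi e
  have b4 := D.height_hi f
  apply hef
  apply D.edge_ext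
  · rcases lt_trichotomy (D.lo e) (D.lo f) with h | h | h
    · exact absurd (by rw [hs, hi]; exact b2) (D.height_ne e _ h a2)
    · exact h
    · exact absurd (by rw [← hs, ← hi]; exact b1) (D.height_ne f _ h a1)
  · rcases lt_trichotomy (D.hi e) (D.hi f) with h | h | h
    · exact absurd (by rw [← hs, ← hi]; exact b3) (D.height_ne f _ a2 h)
    · exact h
    · exact absurd (by rw [hs, hi]; exact b4) (D.height_ne e _ a1 h)

/-- The four endpoints of two crossing edges are distinct. -/
lemma card_endpoints_of_cross [DecidableEq V] {e f : ι} (hef : e ≠ f) (h : D.Cross e f) :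
    ({D.lo e, D.hi e, D.lo f, D.hi f} : Finset V).card = 4 := by
  have hs := slope_ne_of_cross hef h
  obtain ⟨z, h1, h2, h3, h4, h5⟩ := h
  unfold height at h5
  have key : ∀ w : ℝ, w ≠ z →
      D.slope e * w + D.icpt e ≠ D.slope f * w + D.icpt f := by
    intro w hw h
    have : (D.slope e - D.slope f) * (w - z) = 0 := by linarith
    rcases mul_eq_zero.1 this with h | h
    · exact hs (sub_eq_zero.1 h)
    · exact hw (sub_eq_zero.1 h)
  have a1 : D.lo e ≠ D.hi f := by rintro h; rw [h] at h1; linarith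
  have a2 : D.lo f ≠ D.hi e := by rintro h; rw [h] at h3; linarith
  have a3 : D.lo e ≠ D.lo f := by
    intro h
    apply key _ h1.ne
    rw [D.height_lo, h, D.height_lo]
  have a4 : D.hi e ≠ D.hi f := by
    intro h
    apply key _ h2.ne'
    rw [D.height_hi, h, D.height_hi]
  have a5 := (D.lo_lt_hi e).ne
  have a6 := (D.lo_lt_hi f).ne
  rw [Finset.card_insert_of_notMem, Finset.card_insert_of_notMem, Finset.card_pair a6]
  · simp [a2.symm, a4]
  · simp [a1, a3, a5]

end StraightLineDrawing

/-! ### The crossing inequality by random sampling. -/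

/-- The number of `q`-colourings which give colour `0` to all elements of `T`. -/
lemma card_colourings_mul_pow {V : Type*} [Fintype V] [DecidableEq V] (q : ℕ) [NeZero q]
    (T : Finset V) :
    (Finset.univ.filter fun c : V → Fin q => ∀ v ∈ T, c v = 0).card * q ^ T.card =
      q ^ Fintype.card V := by
  have h : (Finset.univ.filter fun c : V → Fin q => ∀ v ∈ T, c v = 0) =
      Fintype.piFinset fun v => if v ∈ T then {0} else Finset.univ := by
    ext c
    simp only [Finset.mem_filter, Finset.mem_univ, true_and, Fintype.mem_piFinset]
    refine forall_congr' fun v => ?_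
    by_cases hv : v ∈ T <;> simp [hv]
  rw [h, Fintype.card_piFinset]
  have h2 : ∀ v, (if v ∈ T then ({0} : Finset (Fin q)) else Finset.univ).card =
      if v ∈ T then 1 else q := by
    intro v; split_ifs <;> simp
  simp_rw [h2]
  have h3 : q ^ T.card = ∏ v, if v ∈ T then q else 1 := by
    rw [Finset.prod_ite_mem, Finset.univ_inter, Finset.prod_const]
  rw [h3, ← Finset.prod_mul_distrib]
  rw [Finset.prod_congr rfl (g := fun _ => q) (fun v _ => by split_ifs <;> simp)]
  simp

/-- Linearity of expectation with denominators cleared: a uniform random colouring gives colour `0`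
to all of a `k`-set with probability `q⁻ᵏ`. -/
lemma sum_card_filter_mul_pow {V α : Type*} [Fintype V] [DecidableEq V] (q : ℕ) [NeZero q]
    (s : Finset α) (T : α → Finset V) (k : ℕ) (hT : ∀ a ∈ s, (T a).card = k)
    (P : (V → Fin q) → α → Prop) [∀ c, DecidablePred (P c)]
    (hP : ∀ c a, P c a ↔ ∀ v ∈ T a, c v = 0) :
    (∑ c : V → Fin q, (s.filter (P c)).card) * q ^ k = s.card * q ^ Fintype.card V := by
  have h : ∑ c : V → Fin q, (s.filter (P c)).card =
      ∑ a ∈ s, (Finset.univ.filter fun c : V → Fin q => ∀ v ∈ T a, c v = 0).card := by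
    simp_rw [Finset.card_filter]
    rw [Finset.sum_comm]
    simp_rw [hP]
  rw [h, Finset.sum_mul, Finset.sum_congr rfl (g := fun _ => q ^ Fintype.card V)]
  · simp
  · intro a ha
    rw [← hT a ha, card_colourings_mul_pow]

namespace StraightLineDrawing

/-- The crossing inequality, in the form obtained by averaging over the vertex sets of density
`1 / q`. -/
theorem card_edges_mul_le {V ι : Type*} [LinearOrder V] [Fintype V] [Fintype ι]
    (D : StraightLineDrawing V ι) (q : ℕ) (hq : 0 < q) :
    Fintype.card ι * q ^ 2 ≤ 3 * Fintype.card V * q ^ 3 + D.crossings.card := by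
  classical
  have : NeZero q := ⟨hq.ne'⟩
  have hE := sum_card_filter_mul_pow (V := V) q (Finset.univ : Finset ι)
    (fun e => {D.lo e, D.hi e}) 2 (fun e _ => Finset.card_pair (D.lo_lt_hi e).ne)
    (fun c e => c (D.lo e) = 0 ∧ c (D.hi e) = 0) (by simp)
  have hV := sum_card_filter_mul_pow (V := V) q (Finset.univ : Finset V)
    (fun v => {v}) 1 (by simp) (fun c v => c v = 0) (by simp)
  have hX := sum_card_filter_mul_pow (V := V) q D.crossings
    (fun p => {D.lo p.1, D.hi p.1, D.lo p.2, D.hi p.2}) 4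
    (fun p hp => by
      obtain ⟨h1, h2⟩ := mem_crossings.1 hp
      exact card_endpoints_of_cross h1 h2)
    (fun c p => (c (D.lo p.1) = 0 ∧ c (D.hi p.1) = 0) ∧ c (D.lo p.2) = 0 ∧ c (D.hi p.2) = 0)
    (by simp [and_assoc])
  have hsum := Finset.sum_le_sum fun (c : V → Fin q) (_ : c ∈ Finset.univ) =>
    D.card_le_add_card_crossings (Finset.univ.filter fun v => c v = 0)
  simp only [Finset.mem_filter, Finset.mem_univ, true_and] at hsum
  rw [Finset.sum_add_distrib, ← Finset.mul_sum] at hsum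
  have hpos : 0 < q ^ Fintype.card V := pow_pos hq _
  rw [Finset.card_univ] at hE hV
  refine Nat.le_of_mul_le_mul_right ?_ hpos
  -- The averaged inequality `E/q² ≤ 3V/q + X/q⁴`, multiplied by `q⁴`.
  have key : ∀ a b c Q : ℕ, a * q ^ 2 = Fintype.card ι * Q → b * q ^ 1 = Fintype.card V * Q →
      c * q ^ 4 = D.crossings.card * Q → a ≤ 3 * b + c →
      Fintype.card ι * q ^ 2 * Q ≤ (3 * Fintype.card V * q ^ 3 + D.crossings.card) * Q := by
    intro a b c Q h1 h2 h3 h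
    calc Fintype.card ι * q ^ 2 * Q = Fintype.card ι * Q * q ^ 2 := by ring
      _ = a * q ^ 4 := by rw [← h1]; ring
      _ ≤ (3 * b + c) * q ^ 4 := Nat.mul_le_mul_right _ h
      _ = 3 * (b * q ^ 1) * q ^ 3 + c * q ^ 4 := by ring
      _ = _ := by rw [h2, h3]; ring
  exact key _ _ _ _ hE hV hX hsum

end StraightLineDrawing

/-! ### Incidences of points and lines. -/

/-- The Szemerédi–Trotter bound, for points with distinct abscissas and non-vertical lines. -/
theorem card_incidences_mul_le {V κ : Type*} [LinearOrder V] [Fintype V] [Fintype κ]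
    (x y : V → ℝ) (hx : StrictMono x) (α β : κ → ℝ)
    (hline : ∀ i j, α i = α j → β i = β j → i = j) (q : ℕ) (hq : 0 < q) :
    {p : κ × V | α p.1 * x p.2 + β p.1 = y p.2}.ncard * q ^ 2 ≤
      Fintype.card κ * q ^ 2 + 3 * Fintype.card V * q ^ 3 + Fintype.card κ ^ 2 := by
  classical
  let inc : κ → V → Prop := fun i v => α i * x v + β i = y v
  have hmeet : ∀ i j : κ, ∀ z w : ℝ, z ≠ w → α i * z + β i = α j * z + β j →
      α i * w + β i = α j * w + β j → i = j := by
    intro i j z w hzw h1 h2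
    have : (α i - α j) * (z - w) = 0 := by linarith
    rcases mul_eq_zero.1 this with h | h
    · have h := sub_eq_zero.1 h
      rw [h] at h1
      exact hline i j h (by linarith)
    · exact absurd (sub_eq_zero.1 h) hzw
  -- An edge is a line together with two consecutive points on it.
  let ι := {e : κ × V × V // e.2.1 < e.2.2 ∧ inc e.1 e.2.1 ∧ inc e.1 e.2.2 ∧
    ∀ v, e.2.1 < v → v < e.2.2 → ¬ inc e.1 v}
  let D : StraightLineDrawing V ι :=
    { x := x
      y := y
      lo := fun e => e.1.2.1
      hi := fun e => e.1.2.2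
      slope := fun e => α e.1.1
      icpt := fun e => β e.1.1
      x_strictMono := hx
      lo_lt_hi := fun e => e.2.1
      height_lo := fun e => e.2.2.1
      height_hi := fun e => e.2.2.2.1
      height_ne := fun e => e.2.2.2.2
      edge_ext := by
        rintro ⟨⟨i, u, v⟩, huv, hu, hv, h⟩ ⟨⟨j, u', v'⟩, huv', hu', hv', h'⟩ h1 h2
        dsimp only at h1 h2
        subst h1 h2
        have := hmeet i j _ _ (hx huv).ne (hu.trans hu'.symm) (hv.trans hv'.symm)
        subst this
        rfl }
  have hX : D.crossings.card ≤ Fintype.card κ ^ 2 := by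
    rw [sq, ← Fintype.card_prod, ← Finset.card_univ]
    refine Finset.card_le_card_of_injOn (fun p => (p.1.1.1, p.2.1.1)) (by simp) ?_
    -- Crossing edges on one line coincide. So a pair of lines determines the crossing point, and
    -- that point determines the edge on each line.
    have hu : ∀ e f : ι, e.1.1 = f.1.1 → D.Cross e f → e = f := by
      intro e f h hc
      by_contra hne
      exact D.slope_ne_of_cross hne hc (congrArg α h)
    rintro ⟨e, f⟩ hef ⟨e', f'⟩ hef' h
    obtain ⟨hne, hc⟩ := StraightLineDrawing.mem_crossings.1 (Finset.mem_coe.1 hef)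
    obtain ⟨hne', hc'⟩ := StraightLineDrawing.mem_crossings.1 (Finset.mem_coe.1 hef')
    obtain ⟨h1, h2⟩ := Prod.mk.inj h
    dsimp only at hne hc hne' hc' h1 h2
    have hlines : e.1.1 ≠ f.1.1 := fun h => hne (hu e f h hc)
    obtain ⟨z, a1, a2, a3, a4, a5⟩ := hc
    obtain ⟨w, b1, b2, b3, b4, b5⟩ := hc'
    have hzw : z = w := by
      by_contra hzw
      refine hlines (hmeet _ _ z w hzw a5 ?_)
      rw [h1, h2]
      exact b5
    subst hzw
    have he : e = e' := hu e e' h1 ⟨z, a1, a2, b1, b2, by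
      change α e.1.1 * z + β e.1.1 = α e'.1.1 * z + β e'.1.1
      rw [h1]⟩
    have hf : f = f' := hu f f' h2 ⟨z, a3, a4, b3, b4, by
      change α f.1.1 * z + β f.1.1 = α f'.1.1 * z + β f'.1.1
      rw [h2]⟩
    rw [he, hf]
  -- Each incidence is leftmost on its line (`M`) or the right end of an edge (`N`).
  have hI : {p : κ × V | α p.1 * x p.2 + β p.1 = y p.2}.ncard ≤
      Fintype.card κ + Fintype.card ι := by
    let M := Finset.univ.filter fun p : κ × V => inc p.1 p.2 ∧ ∀ u, inc p.1 u → p.2 ≤ u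
    let N := (Finset.univ : Finset ι).image fun e => (e.1.1, e.1.2.2)
    have hsub : {p : κ × V | α p.1 * x p.2 + β p.1 = y p.2} ⊆ ((M ∪ N : Finset (κ × V)) : Set _) := by
      rintro ⟨i, v⟩ hp
      have hp : inc i v := hp
      rw [Finset.mem_coe, Finset.mem_union]
      by_cases hmin : ∀ u, inc i u → v ≤ u
      · exact Or.inl (Finset.mem_filter.2 ⟨Finset.mem_univ _, hp, hmin⟩)
      · right
        push Not at hmin
        obtain ⟨u₀, hu₀, hlt⟩ := hmin
        obtain ⟨u, hu, hmax⟩ := (Finset.univ.filter fun u => inc i u ∧ u < v).exists_max_image id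
          ⟨u₀, by simp [hu₀, hlt]⟩
        obtain ⟨hu1, hu2⟩ := (Finset.mem_filter.1 hu).2
        refine Finset.mem_image.2 ⟨⟨(i, u, v), hu2, hu1, hp, fun w hw1 hw2 hw => ?_⟩,
          Finset.mem_univ _, rfl⟩
        exact absurd (hmax w (by simp [hw, hw2])) (not_le.2 hw1)
    have hM : M.card ≤ Fintype.card κ := by
      rw [← Finset.card_univ]
      refine Finset.card_le_card_of_injOn Prod.fst (by simp) ?_
      rintro ⟨i, u⟩ hu ⟨j, v⟩ hv h
      obtain ⟨hu1, hu2⟩ := (Finset.mem_filter.1 (Finset.mem_coe.1 hu)).2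
      obtain ⟨hv1, hv2⟩ := (Finset.mem_filter.1 (Finset.mem_coe.1 hv)).2
      dsimp only at h hu1 hu2 hv1 hv2
      subst h
      rw [le_antisymm (hu2 v hv1) (hv2 u hu1)]
    have hN : N.card ≤ Fintype.card ι := Finset.card_image_le
    calc _ ≤ ((M ∪ N : Finset (κ × V)) : Set _).ncard := Set.ncard_le_ncard hsub (Finset.finite_toSet _)
      _ = (M ∪ N).card := Set.ncard_coe_finset _
      _ ≤ _ := (Finset.card_union_le _ _).trans (add_le_add hM hN)
  have hE := D.card_edges_mul_le q hq
  calc _ ≤ (Fintype.card κ + Fintype.card ι) * q ^ 2 := Nat.mul_le_mul_right _ hI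
    _ ≤ _ := by rw [add_mul]; omega

/-! ### Minors of two-rowed matrices -/

lemma orderEmbedding_fin_two_apply (I : Fin 2 ↪o Fin 2) : I 0 = 0 ∧ I 1 = 1 := by
  have h : I 0 < I 1 := I.strictMono (by decide)
  omega

lemma minor_two {n : ℕ} (A : Matrix (Fin 2) (Fin n) ℝ) (I : Fin 2 ↪o Fin 2) (J : Fin 2 ↪o Fin n) :
    minor A I J = A 0 (J 0) * A 1 (J 1) - A 0 (J 1) * A 1 (J 0) := by
  obtain ⟨h0, h1⟩ := orderEmbedding_fin_two_apply I
  simp [minor, Matrix.det_fin_two, h0, h1]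

/-- The increasing enumeration of a pair. -/
def pairEmbedding {n : ℕ} {i j : Fin n} (h : i < j) : Fin 2 ↪o Fin n :=
  OrderEmbedding.ofStrictMono ![i, j] (by
    intro a b hab
    fin_cases a <;> fin_cases b <;> simp_all)

lemma minorCount_two {n : ℕ} (A : Matrix (Fin 2) (Fin n) ℝ) (v : ℝ) :
    minorCount 2 A v =
      {p : Fin n × Fin n | p.1 < p.2 ∧ A 0 p.1 * A 1 p.2 - A 0 p.2 * A 1 p.1 = v}.ncard := by
  have hinj : Function.Injective
      fun p : (Fin 2 ↪o Fin 2) × (Fin 2 ↪o Fin n) => (p.2 0, p.2 1) := by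
    rintro ⟨I, J⟩ ⟨I', J'⟩ h
    obtain ⟨h0, h1⟩ := Prod.mk.inj h
    obtain ⟨a0, a1⟩ := orderEmbedding_fin_two_apply I
    obtain ⟨b0, b1⟩ := orderEmbedding_fin_two_apply I'
    refine Prod.ext (DFunLike.ext _ _ fun i => ?_) (DFunLike.ext _ _ fun i => ?_)
    · fin_cases i
      · exact a0.trans b0.symm
      · exact a1.trans b1.symm
    · fin_cases i
      · exact h0
      · exact h1
  rw [minorCount, ← Set.ncard_image_of_injective _ hinj]
  congr 1
  ext ⟨i, j⟩
  constructor
  · rintro ⟨⟨I, J⟩, hIJ, h⟩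
    obtain ⟨rfl, rfl⟩ := Prod.mk.inj h
    refine ⟨J.strictMono (by decide), ?_⟩
    rw [← minor_two A I J]
    exact hIJ
  · rintro ⟨hij, h⟩
    refine ⟨⟨RelEmbedding.refl _, pairEmbedding hij⟩, ?_, rfl⟩
    change minor A _ _ = v
    rw [minor_two]
    exact h

lemma IsTotallyPositive.entry_pos {m n : ℕ} {A : Matrix (Fin m) (Fin n) ℝ}
    (hA : IsTotallyPositive A) (i : Fin m) (j : Fin n) : 0 < A i j := by
  have h := hA 1 (OrderEmbedding.ofStrictMono (fun _ => i) (Subsingleton.strictMono _))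
    (OrderEmbedding.ofStrictMono (fun _ => j) (Subsingleton.strictMono _))
  simpa [minor, Matrix.det_fin_one] using h

lemma IsTotallyPositive.det_pos {n : ℕ} {A : Matrix (Fin 2) (Fin n) ℝ}
    (hA : IsTotallyPositive A) {i j : Fin n} (hij : i < j) :
    0 < A 0 i * A 1 j - A 0 j * A 1 i := by
  have h := hA 2 (RelEmbedding.refl _) (pairEmbedding hij)
  rw [minor_two] at h
  exact h

lemma isTotallyPositive_of_two_rows {n : ℕ} {A : Matrix (Fin 2) (Fin n) ℝ}
    (h1 : ∀ i j, 0 < A i j) (h2 : ∀ i j, i < j → 0 < A 0 i * A 1 j - A 0 j * A 1 i) :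
    IsTotallyPositive A := by
  intro k I J
  match k, I, J with
  | 0, I, J => simp [minor]
  | 1, I, J => simpa [minor, Matrix.det_fin_one] using h1 _ _
  | 2, I, J =>
    rw [minor_two]
    exact h2 _ _ (J.strictMono (by decide))
  | k + 3, I, J =>
    have := Fintype.card_le_of_embedding I.toEmbedding
    simp at this

/-! ### The upper bound -/

/-- Column `i` plays the line and column `j` the point; the order `i < j` is dropped when counting
incidences. For `v ≤ 0` there is nothing to count. -/
lemma minorCount_two_mul_le {n : ℕ} {A : Matrix (Fin 2) (Fin n) ℝ} (hA : IsTotallyPositive A)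
    (v : ℝ) (q : ℕ) (hq : 0 < q) :
    minorCount 2 A v * q ^ 2 ≤ n * q ^ 2 + 3 * n * q ^ 3 + n ^ 2 := by
  rw [minorCount_two]
  rcases le_or_gt v 0 with hv | hv
  · have : {p : Fin n × Fin n | p.1 < p.2 ∧ A 0 p.1 * A 1 p.2 - A 0 p.2 * A 1 p.1 = v} = ∅ := by
      refine Set.eq_empty_of_forall_notMem ?_
      rintro p ⟨h1, h2⟩
      have := hA.det_pos h1
      linarith
    simp [this]
  have hpos := hA.entry_pos
  have hx : StrictMono fun j => A 1 j / A 0 j := by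
    intro i j hij
    rw [div_lt_div_iff₀ (hpos 0 i) (hpos 0 j)]
    have := hA.det_pos hij
    linarith
  have hline : ∀ i j : Fin n, A 0 i / v = A 0 j / v → -(A 1 i / v) = -(A 1 j / v) → i = j := by
    intro i j h0 h1
    rw [div_left_inj' hv.ne'] at h0
    rw [neg_inj, div_left_inj' hv.ne'] at h1
    refine hx.injective ?_
    simp only [h0, h1]
  have h := card_incidences_mul_le (fun j => A 1 j / A 0 j) (fun j => 1 / A 0 j) hx
    (fun i => A 0 i / v) (fun i => -(A 1 i / v)) hline q hq
  rw [Fintype.card_fin] at h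
  refine le_trans (Nat.mul_le_mul_right _ (Set.ncard_le_ncard ?_ (Set.toFinite _))) h
  rintro ⟨i, j⟩ ⟨-, hij⟩
  change A 0 i / v * (A 1 j / A 0 j) + -(A 1 i / v) = 1 / A 0 j
  have := (hpos 0 j).ne'
  field_simp
  dsimp only at hij
  linarith

lemma rpow_four_thirds {x : ℝ} (hx : 0 ≤ x) : x ^ (4 / 3 : ℝ) = (x ^ (1 / 3 : ℝ)) ^ 4 := by
  rw [← Real.rpow_natCast, ← Real.rpow_mul hx]
  norm_num

lemma rpow_one_third_pow {x : ℝ} (hx : 0 ≤ x) : (x ^ (1 / 3 : ℝ)) ^ 3 = x := by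
  rw [← Real.rpow_natCast, ← Real.rpow_mul hx]
  norm_num

theorem minorCount_two_le {n : ℕ} {A : Matrix (Fin 2) (Fin n) ℝ} (hA : IsTotallyPositive A)
    (v : ℝ) : (minorCount 2 A v : ℝ) ≤ 8 * (n : ℝ) ^ (4 / 3 : ℝ) := by
  rcases Nat.eq_zero_or_pos n with rfl | hn
  · have h := minorCount_two_mul_le hA v 1 one_pos
    have h0 : minorCount 2 A v = 0 := by omega
    rw [h0]
    norm_num
  set r : ℝ := (n : ℝ) ^ (1 / 3 : ℝ) with hr
  have hr3 : r ^ 3 = n := rpow_one_third_pow (Nat.cast_nonneg n)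
  have hr1 : 1 ≤ r := Real.one_le_rpow (by exact_mod_cast hn) (by norm_num)
  rw [rpow_four_thirds (Nat.cast_nonneg n), ← hr]
  -- With `q` about `n^(1/3)` all terms are `O(n^(4/3) q²)`; as `q ≤ 2r`, their constants are `1`,
  -- `6` and `1`.
  set q := ⌈r⌉₊
  have hq1 : r ≤ q := Nat.le_ceil r
  have hq2 : (q : ℝ) ≤ 2 * r := by
    have := Nat.ceil_lt_add_one (zero_le_one.trans hr1)
    linarith
  have hq : 0 < q := Nat.ceil_pos.2 (by linarith)
  have h := minorCount_two_mul_le hA v q hq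
  have h : (minorCount 2 A v : ℝ) * q ^ 2 ≤ n * q ^ 2 + 3 * n * q ^ 3 + n ^ 2 := by
    exact_mod_cast h
  rw [← hr3] at h
  have hq0 : (0 : ℝ) < (q : ℝ) ^ 2 := by positivity
  refine le_of_mul_le_mul_right (h.trans ?_) hq0
  have e1 : r ^ 3 * (q : ℝ) ^ 2 ≤ r ^ 4 * q ^ 2 := by gcongr; norm_num
  have e2 : 3 * r ^ 3 * (q : ℝ) ^ 3 ≤ 6 * r ^ 4 * q ^ 2 := by
    calc 3 * r ^ 3 * (q : ℝ) ^ 3 = 3 * r ^ 3 * q ^ 2 * q := by ring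
      _ ≤ 3 * r ^ 3 * q ^ 2 * (2 * r) := by gcongr
      _ = _ := by ring
  have e3 : (r ^ 3) ^ 2 ≤ r ^ 4 * (q : ℝ) ^ 2 := by
    calc (r ^ 3) ^ 2 = r ^ 4 * r ^ 2 := by ring
      _ ≤ _ := by gcongr
  linarith

/-! ### The lower bound -/

/-- Vectors `ρ a • (1, τ a)` with distinct directions can be arranged as the columns of a totally
positive matrix. -/
lemma exists_isTotallyPositive_of_directions {n : ℕ} {ι : Type*} [Fintype ι]
    (hι : Fintype.card ι = n) (τ ρ : ι → ℝ) (hτ : Function.Injective τ) (hτ0 : ∀ a, 0 < τ a)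
    (hρ0 : ∀ a, 0 < ρ a) :
    ∃ A : Matrix (Fin 2) (Fin n) ℝ, IsTotallyPositive A ∧ ∀ v : ℝ, 0 < v →
      {p : ι × ι | ρ p.1 * ρ p.2 * (τ p.2 - τ p.1) = v}.ncard ≤ minorCount 2 A v := by
  let g : Fin n ≃ ι := (Fintype.equivFinOfCardEq hι).symm
  let e : Fin n ≃ ι := (Tuple.sort (τ ∘ g)).trans g
  have he : StrictMono (τ ∘ e) :=
    (show Monotone (τ ∘ e) from Tuple.monotone_sort (τ ∘ g)).strictMono_of_injective
      (hτ.comp e.injective)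
  let A : Matrix (Fin 2) (Fin n) ℝ := Matrix.of ![fun j => ρ (e j), fun j => ρ (e j) * τ (e j)]
  have hA0 : ∀ j, A 0 j = ρ (e j) := fun j => rfl
  have hA1 : ∀ j, A 1 j = ρ (e j) * τ (e j) := fun j => rfl
  have hdet : ∀ i j, A 0 i * A 1 j - A 0 j * A 1 i = ρ (e i) * ρ (e j) * (τ (e j) - τ (e i)) := by
    intro i j
    simp only [hA0, hA1]
    ring
  refine ⟨A, isTotallyPositive_of_two_rows ?_ ?_, fun v hv => ?_⟩
  · intro i j
    fin_cases i
    · exact hρ0 _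
    · exact mul_pos (hρ0 _) (hτ0 _)
  · intro i j hij
    rw [hdet]
    exact mul_pos (mul_pos (hρ0 _) (hρ0 _)) (sub_pos.2 (he hij))
  · rw [minorCount_two]
    refine Set.ncard_le_ncard_of_injOn (fun p => (e.symm p.1, e.symm p.2)) ?_ ?_ (Set.toFinite _)
    · rintro ⟨a, b⟩ hab
      have hab : ρ a * ρ b * (τ b - τ a) = v := hab
      -- Since `v > 0`, a pair with value `v` is already in increasing order of `τ`.
      refine ⟨he.lt_iff_lt.1 ?_, ?_⟩
      · have h := pos_of_mul_pos_right (hab ▸ hv) (mul_pos (hρ0 a) (hρ0 b)).le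
        simpa using sub_pos.1 h
      · rw [hdet]
        simpa using hab
    · rintro ⟨a, b⟩ - ⟨a', b'⟩ - h
      simpa using h

/-- The grid construction: `k ^ 3` lines and at least `2 * k ^ 3 - 1` points with `k ^ 4`
incidences. -/
lemma exists_minorCount_ge (k n : ℕ) (hk : 0 < k) (hn : 3 * k ^ 3 ≤ n + 1) :
    ∃ A : Matrix (Fin 2) (Fin n) ℝ, IsTotallyPositive A ∧ k ^ 4 ≤ minorCount 2 A 1 := by
  have hk3 : 1 ≤ k ^ 3 := Nat.one_le_pow _ _ hk
  obtain ⟨N, hN⟩ : ∃ N, N = 2 * k ^ 2 := ⟨_, rfl⟩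
  have hN0 : 0 < N := by rw [hN]; positivity
  have hNR : (0 : ℝ) < N := by exact_mod_cast hN0
  let w : ℝ := √2
  have hw : 0 < w := by positivity
  -- The index `(m, c)` stands for the line `y = (m+1)x + c`. The shift by `√2` keeps the directions
  -- of lines with different slopes distinct, by irrationality.
  let z : Fin k × Fin (k ^ 2) → ℝ := fun l => -(N * (w + l.2) / ((l.1 : ℕ) + 1)) - w
  have hz : Function.Injective z := by
    rintro ⟨m, c⟩ ⟨m', c'⟩ h
    have hm : (0 : ℝ) < (m : ℕ) + 1 := by positivity
    have hm' : (0 : ℝ) < (m' : ℕ) + 1 := by positivity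
    have h1 : (w + (c : ℕ)) * ((m' : ℕ) + 1) = (w + (c' : ℕ)) * ((m : ℕ) + 1) := by
      have h : (N : ℝ) * (w + (c : ℕ)) / ((m : ℕ) + 1) = N * (w + (c' : ℕ)) / ((m' : ℕ) + 1) := by
        simp only [z] at h
        linarith
      rw [div_eq_div_iff hm.ne' hm'.ne', mul_assoc, mul_assoc] at h
      exact mul_left_cancel₀ hNR.ne' h
    have hmm : (m' : ℕ) = m := by
      by_contra hne
      have hne' : ((m' : ℕ) : ℝ) - (m : ℕ) ≠ 0 := sub_ne_zero.2 (by exact_mod_cast hne)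
      refine irrational_sqrt_two ⟨(((c' : ℕ) : ℚ) * ((m : ℕ) + 1) - (c : ℕ) * ((m' : ℕ) + 1)) /
        ((m' : ℕ) - (m : ℕ)), ?_⟩
      push_cast
      rw [div_eq_iff hne']
      change _ = w * _
      linarith
    rw [hmm] at h1
    have hcc := mul_right_cancel₀ hm.ne' h1
    have hcc : (c : ℕ) = c' := by exact_mod_cast add_left_cancel hcc
    exact Prod.ext (Fin.ext hmm.symm) (Fin.ext hcc)
  have hzneg : ∀ l, z l < 0 := by
    intro l
    have : 0 ≤ (N : ℝ) * (w + (l.2 : ℕ)) / ((l.1 : ℕ) + 1) := by positivity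
    simp only [z]
    linarith
  -- Translating all `τ` by `T` makes them positive without changing their differences.
  obtain ⟨T, hT⟩ : ∃ T : ℝ, ∀ l, 0 < T + z l := by
    obtain ⟨B, hB⟩ := (Set.finite_range z).bddBelow
    refine ⟨1 - B, fun l => ?_⟩
    have := hB ⟨l, rfl⟩
    linarith
  have hT0 : 0 < T := by
    have h1 := hT (⟨0, hk⟩, ⟨0, by positivity⟩)
    have h2 := hzneg (⟨0, hk⟩, ⟨0, by positivity⟩)
    linarith
  let ι := (Fin k × Fin (k ^ 2)) ⊕ Fin (n - k ^ 3)
  -- The grid point `(a, b)` with `b < N` is encoded as `t = N a + b`. If `b = (m+1)a + c`, the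
  -- difference of `τ` is `(b+w)(N+m+1)/(m+1)`, which the two values of `ρ` cancel.
  let τ : ι → ℝ := Sum.elim (fun l => T + z l) (fun t => T + (t : ℕ))
  let ρ : ι → ℝ := Sum.elim (fun l => ((l.1 : ℕ) + 1) / (N + ((l.1 : ℕ) + 1)))
    (fun t => 1 / (((t : ℕ) % N : ℕ) + w))
  have hτ : Function.Injective τ := by
    have hlt : ∀ (l : Fin k × Fin (k ^ 2)) (t : Fin (n - k ^ 3)), T + z l < T + ((t : ℕ) : ℝ) := by
      intro l t
      have h1 := hzneg l
      have h2 : (0 : ℝ) ≤ (t : ℕ) := Nat.cast_nonneg _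
      linarith
    rintro (l | t) (l' | t') h
    · exact congrArg _ (hz (add_left_cancel h))
    · exact absurd h (hlt l t').ne
    · exact absurd h (hlt l' t).ne'
    · have h : ((t : ℕ) : ℝ) = (t' : ℕ) := add_left_cancel h
      exact congrArg _ (Fin.ext (by exact_mod_cast h))
  obtain ⟨A, hA, hcount⟩ := exists_isTotallyPositive_of_directions (n := n) (ι := ι)
    (by
      simp only [ι, Fintype.card_sum, Fintype.card_prod, Fintype.card_fin]
      rw [show k * k ^ 2 = k ^ 3 by ring]
      omega) τ ρ hτ
    (by
      rintro (l | t)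
      · exact hT l
      · change 0 < T + ((t : ℕ) : ℝ)
        positivity)
    (by
      rintro (l | t)
      · change 0 < (((l.1 : ℕ) : ℝ) + 1) / (N + ((l.1 : ℕ) + 1))
        positivity
      · change 0 < 1 / ((((t : ℕ) % N : ℕ) : ℝ) + w)
        positivity)
  refine ⟨A, hA, le_trans ?_ (hcount 1 one_pos)⟩
  have hrow : ∀ (m : Fin k) (c : Fin (k ^ 2)) (a : Fin k),
      ((m : ℕ) + 1) * a + c < N := by
    intro m c a
    have h1 : ((m : ℕ) + 1) * a ≤ k * k := Nat.mul_le_mul m.2 a.2.le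
    have h2 := c.2
    rw [← sq] at h1
    omega
  have hbd : ∀ (m : Fin k) (c : Fin (k ^ 2)) (a : Fin k),
      N * a + (((m : ℕ) + 1) * a + c) < n - k ^ 3 := by
    intro m c a
    obtain ⟨j, hj⟩ : ∃ j, k = j + 1 := ⟨k - 1, by omega⟩
    have ha : (a : ℕ) ≤ j := by have := a.2; omega
    have h1 : ((m : ℕ) + 1) * a ≤ k * j := Nat.mul_le_mul m.2 ha
    have h2 : N * a ≤ N * j := Nat.mul_le_mul_left _ ha
    have h3 := c.2
    -- The largest code used is `2k³ - k - 1`, so the `2k³ - 1` indices guaranteed by `3k³ ≤ n + 1`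
    -- suffice.
    have h4 : N * j + k * j + k ^ 2 + k = 2 * k ^ 3 := by
      rw [hN, hj]; ring
    omega
  let φ : (Fin k × Fin (k ^ 2)) × Fin k → ι × ι := fun p =>
    (Sum.inl p.1, Sum.inr ⟨_, hbd p.1.1 p.1.2 p.2⟩)
  have hφ : Function.Injective φ := by
    rintro ⟨⟨m, c⟩, a⟩ ⟨⟨m', c'⟩, a'⟩ h
    obtain ⟨h1, h2⟩ := Prod.mk.inj h
    have h1 := Sum.inl.inj h1
    obtain ⟨rfl, rfl⟩ := Prod.mk.inj h1
    have h2 : N * (a : ℕ) + (((m : ℕ) + 1) * a + c) = N * (a' : ℕ) + (((m : ℕ) + 1) * a' + c) :=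
      congrArg Fin.val (Sum.inr.inj h2)
    have h3 : (N + ((m : ℕ) + 1)) * (a : ℕ) = (N + ((m : ℕ) + 1)) * a' := by linarith
    have h4 := Nat.eq_of_mul_eq_mul_left (by omega) h3
    rw [Fin.ext h4]
  have hcard : k ^ 4 = (Set.range φ).ncard := by
    rw [← Set.image_univ, Set.ncard_image_of_injective _ hφ, Set.ncard_univ, Nat.card_eq_fintype_card]
    simp only [Fintype.card_prod, Fintype.card_fin]
    ring
  rw [hcard]
  refine Set.ncard_le_ncard ?_ (Set.toFinite _)
  rintro _ ⟨⟨⟨m, c⟩, a⟩, rfl⟩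
  have hmod : (N * (a : ℕ) + (((m : ℕ) + 1) * a + c)) % N = ((m : ℕ) + 1) * a + c := by
    rw [Nat.mul_add_mod, Nat.mod_eq_of_lt (hrow m c a)]
  change (((m : ℕ) : ℝ) + 1) / (N + ((m : ℕ) + 1)) *
    (1 / (((N * (a : ℕ) + (((m : ℕ) + 1) * a + c)) % N : ℕ) + w)) *
    (T + ((N * (a : ℕ) + (((m : ℕ) + 1) * a + c) : ℕ) : ℝ) -
      (T + (-(N * (w + (c : ℕ)) / ((m : ℕ) + 1)) - w))) = 1
  rw [hmod]
  push_cast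
  have d1 : (0 : ℝ) < (m : ℕ) + 1 := by positivity
  have d2 : (0 : ℝ) < N + ((m : ℕ) + 1) := by positivity
  have d3 : (0 : ℝ) < ((m : ℕ) + 1) * (a : ℕ) + (c : ℕ) + w := by positivity
  field_simp
  ring

lemma exists_rpow_le_minorCount {n : ℕ} (hn : 2 ≤ n) :
    ∃ A : Matrix (Fin 2) (Fin n) ℝ, IsTotallyPositive A ∧
      (1 / 81 : ℝ) * (n : ℝ) ^ (4 / 3 : ℝ) ≤ (minorCount 2 A 1 : ℝ) := by
  -- The largest admissible `k`; the `+ 1` makes `k = 1` admissible already for `n = 2`.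
  obtain ⟨k, hk, hk0, hlt⟩ : ∃ k, 3 * k ^ 3 ≤ n + 1 ∧ 0 < k ∧ n + 1 < 3 * (k + 1) ^ 3 := by
    have hex : ∃ m, n + 1 < 3 * (m + 1) ^ 3 := ⟨n, by nlinarith [Nat.le_self_pow (n := 3) (by norm_num) (n + 1)]⟩
    refine ⟨Nat.find hex, ?_, ?_, Nat.find_spec hex⟩
    · rcases h : Nat.find hex with _ | m
      · simp
      · exact not_lt.1 (Nat.find_min hex (m := m) (by omega))
    · rw [Nat.find_pos]
      omega
  obtain ⟨A, hA, hc⟩ := exists_minorCount_ge k n hk0 hk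
  refine ⟨A, hA, ?_⟩
  have hc' : (k : ℝ) ^ 4 ≤ minorCount 2 A 1 := by exact_mod_cast hc
  refine le_trans ?_ hc'
  set r : ℝ := (n : ℝ) ^ (1 / 3 : ℝ) with hr
  have hr3 : r ^ 3 = n := rpow_one_third_pow (Nat.cast_nonneg n)
  have hr0 : 0 ≤ r := by positivity
  rw [rpow_four_thirds (Nat.cast_nonneg n), ← hr]
  -- In fact `n < 24k³`; the cube `27` gives `n^(1/3) ≤ 3k`, whence the constant `1/81 = 3⁻⁴`.
  have hn27 : n ≤ 27 * k ^ 3 := by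
    have h : (k + 1) ^ 3 ≤ (2 * k) ^ 3 := Nat.pow_le_pow_left (by omega) 3
    rw [mul_pow] at h
    omega
  have hrk : r ≤ 3 * k := by
    refine le_of_pow_le_pow_left₀ (n := 3) (by norm_num) (by positivity) ?_
    rw [hr3, mul_pow]
    norm_num
    exact_mod_cast hn27
  have h4 : r ^ 4 ≤ (3 * k) ^ 4 := pow_le_pow_left₀ hr0 hrk 4
  rw [mul_pow] at h4
  linarith

theorem theorem2 :
    (∃ C : ℝ, ∀ (n : ℕ) (A : Matrix (Fin 2) (Fin n) ℝ), IsTotallyPositive A →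
      ∀ v : ℝ, (minorCount 2 A v : ℝ) ≤ C * (n : ℝ) ^ (4 / 3 : ℝ)) ∧
    (∃ c : ℝ, 0 < c ∧ ∀ n : ℕ, 2 ≤ n →
      ∃ A : Matrix (Fin 2) (Fin n) ℝ, IsTotallyPositive A ∧
        ∃ v : ℝ, c * (n : ℝ) ^ (4 / 3 : ℝ) ≤ (minorCount 2 A v : ℝ)) := by
  refine ⟨⟨8, fun n A hA v => minorCount_two_le hA v⟩, 1 / 81, by norm_num, fun n hn => ?_⟩
  obtain ⟨A, hA, h⟩ := exists_rpow_le_minorCount hn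
  exact ⟨A, hA, 1, h⟩
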